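/- Let $M$ be an open (that is, connected, complete and non-compact) smooth Riemannian $n$-manifold with $\mathrm{Ric}_M\ge 0$, let $\pi:\widetilde M\to M$ be its Riemannian universal covering, and let $p\in M$, $\tilde p\in\widetilde M$ with $\pi(\tilde p)=p$. Let $\Gamma=\pi_1(M,p)$ act on $\widetilde M$ by deck transformations through path lifting: $\gamma\in\Gamma$ acts as the deck transformation that sends $\tilde p$ to the endpoint of the lift of $\gamma$ starting at $\tilde p$. Suppose that $\Gamma$ is nontrivial and torsion free, i.e. its only element of finite order is the identity. Let $s_i>0$ with $s_i\to\infty$, and suppose that $$(s_i^{-1}\widetilde M,\tilde p,\Gamma)\longrightarrow (C_\infty\widetilde M,\tilde o,G)$$ in the pointed equivariant Gromov–Hausdorff topology, where $C_\infty\widetilde M$ is a proper metric space and $G$ is a closed group of isometries of it. Then the orbit $G\cdot\tilde o$, with the subspace topology of $C_\infty\widetilde M$, is not discrete. Here $s_i^{-1}\widetilde M$ is $\widetilde M$ with its Riemannian distance divided by $s_i$. Convergence $(X_i,x_i,\Gamma_i)\to(Y,y,G)$ means that there are $\varepsilon_i>0$, $\varepsilon_i\to0$, and maps $f_i:B_{1/\varepsilon_i}(x_i)\to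 Y$, $\varphi_i:\Gamma_i(1/\varepsilon_i)\to G(1/\varepsilon_i)$, $\psi_i:G(1/\varepsilon_i)\to\Gamma_i(1/\varepsilon_i)$, where $\Gamma_i(R)=\{\gamma\in\Gamma_i: d(\gamma x_i,x_i)<R\}$ and $G(R)=\{g\in G: d(gy,y)<R\}$, such that: $f_i(x_i)=y$; the $\varepsilon_i$-neighbourhood of the image of $f_i$ contains $B_{1/\varepsilon_i}(y)$; $|d(f_i(x),f_i(x'))-d(x,x')|<\varepsilon_i$ for all $x,x'\in B_{1/\varepsilon_i}(x_i)$; $d(f_i(\gamma x),\varphi_i(\gamma)f_i(x))<\varepsilon_i$ whenever $\gamma\in\Gamma_i(1/\varepsilon_i)$ and $x,\gamma x\in B_{1/\varepsilon_i}(x_i)$; and $d(f_i(\psi_i(g)x),g f_i(x))<\varepsilon_i$ whenever $g\in G(1/\varepsilon_i)$ and $x,\psi_i(g)x\in B_{1/\varepsilon_i}(x_i)$. -/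

import Mathlib

open Filter Topology
open scoped Manifold ContDiff Bundle

noncomputable section

/-! ### Ricci curvature in local coordinates -/

section Ricci

variable {n : ℕ} {M : Type*} [TopologicalSpace M] [ChartedSpace (EuclideanSpace ℝ (Fin n)) M]
  [Bundle.RiemannianBundle (fun x : M => TangentSpace (𝓡 n) x)]

/-- The `i`-th standard basis vector, as a tangent vector at `u` to Euclidean space. -/
def basisVector (i : Fin n) (u : EuclideanSpace ℝ (Fin n)) :
    TangentSpace 𝓘(ℝ, EuclideanSpace ℝ (Fin n)) u :=
  (EuclideanSpace.single i (1 : ℝ) : EuclideanSpace ℝ (Fin n))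

/-- The coordinate vector field `∂_i` of the preferred chart around `x₀`, at the point with
coordinates `u`. -/
def coordVector (x₀ : M) (i : Fin n) (u : EuclideanSpace ℝ (Fin n)) :
    TangentSpace (𝓡 n) ((extChartAt (𝓡 n) x₀).symm u) :=
  mfderiv 𝓘(ℝ, EuclideanSpace ℝ (Fin n)) (𝓡 n) (extChartAt (𝓡 n) x₀).symm u (basisVector i u)

/-- The matrix `g_{ij}(u) = ⟨∂_i, ∂_j⟩` of the Riemannian metric at the point with coordinates `u`
in the preferred chart around `x₀`. -/
def metricMatrix (x₀ : M) (u : EuclideanSpace ℝ (Fin n)) : Matrix (Fin n) (Fin n) ℝ :=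
  Matrix.of fun i j => inner ℝ (coordVector x₀ i u) (coordVector x₀ j u)

/-- The partial derivative `∂_i h (u)` of a real function on Euclidean space. -/
def partialDeriv (i : Fin n) (h : EuclideanSpace ℝ (Fin n) → ℝ)
    (u : EuclideanSpace ℝ (Fin n)) : ℝ :=
  fderiv ℝ h u (EuclideanSpace.single i (1 : ℝ))

/-- The Christoffel symbols
`Γ^k_{ij} = ½ ∑_l g^{kl} (∂_i g_{jl} + ∂_j g_{il} - ∂_l g_{ij})` in the chart around `x₀`. -/
def christoffel (x₀ : M) (k i j : Fin n) (u : EuclideanSpace ℝ (Fin n)) : ℝ :=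
  (1 / 2 : ℝ) * ∑ l, (metricMatrix x₀ u)⁻¹ k l *
    (partialDeriv i (fun w => metricMatrix x₀ w j l) u
      + partialDeriv j (fun w => metricMatrix x₀ w i l) u
      - partialDeriv l (fun w => metricMatrix x₀ w i j) u)

/-- The components of the Ricci tensor in the chart around `x₀`:
`R_{ij} = ∑_k (∂_k Γ^k_{ij} - ∂_j Γ^k_{ki}) + ∑_{k,l} (Γ^k_{kl} Γ^l_{ij} - Γ^k_{jl} Γ^l_{ik})`. -/
def ricciCoeff (x₀ : M) (i j : Fin n) (u : EuclideanSpace ℝ (Fin n)) : ℝ :=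
  (∑ k, (partialDeriv k (christoffel x₀ k i j) u - partialDeriv j (christoffel x₀ k k i) u))
    + ∑ k, ∑ l, (christoffel x₀ k k l u * christoffel x₀ l i j u
        - christoffel x₀ k j l u * christoffel x₀ l i k u)

variable (n M) in
/-- `Ric ≥ 0`: the Ricci tensor is a nonnegative quadratic form at every point
(of every preferred chart). -/
def RicciNonneg : Prop :=
  ∀ x₀ : M, ∀ u ∈ (extChartAt (𝓡 n) x₀).target, ∀ v : Fin n → ℝ,
    0 ≤ ∑ i, ∑ j, ricciCoeff x₀ i j u * v i * v j

end Ricci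

/-! ### Riemannian coverings and the action of the fundamental group by path lifting -/

/-- A Riemannian covering: a covering map which is a local diffeomorphism and whose differential
is isometric at every point. -/
structure IsRiemannianCovering (n : ℕ) {X M : Type*}
    [TopologicalSpace X] [ChartedSpace (EuclideanSpace ℝ (Fin n)) X]
    [Bundle.RiemannianBundle (fun x : X => TangentSpace (𝓡 n) x)]
    [TopologicalSpace M] [ChartedSpace (EuclideanSpace ℝ (Fin n)) M]
    [Bundle.RiemannianBundle (fun x : M => TangentSpace (𝓡 n) x)]
    (pr : X → M) : Prop where
  isCoveringMap : IsCoveringMap pr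
  isLocalDiffeomorph : IsLocalDiffeomorph (𝓡 n) (𝓡 n) ∞ pr
  norm_mfderiv : ∀ (x : X) (v : TangentSpace (𝓡 n) x), ‖mfderiv (𝓡 n) (𝓡 n) pr x v‖ = ‖v‖

section Deck

variable {X M : Type*} [TopologicalSpace X] [TopologicalSpace M]

/-- For a simply connected covering `pr : X → M` and `pr x = p`, every `γ ∈ π₁(M, p)` determines a
unique deck transformation, namely the lift of `pr` through `pr` that sends `x` to the endpoint of
the lift of `γ` starting at `x`. -/
theorem existsUnique_deck [SimplyConnectedSpace X] [LocallyPathConnectedSpace X] {pr : X → M}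
    (cov : IsCoveringMap pr) {x : X} {p : M} (hx : pr x = p) (γ : FundamentalGroup M p) :
    ∃! F : C(X, X), F x = (cov.monodromy γ ⟨x, hx⟩ : pr ⁻¹' {p}).1 ∧ pr ∘ F = pr := by
  have h2 : pr (cov.monodromy γ ⟨x, hx⟩ : pr ⁻¹' {p}).1 = p :=
    (cov.monodromy γ ⟨x, hx⟩ : pr ⁻¹' {p}).2
  exact cov.existsUnique_continuousMap_lifts ⟨pr, cov.continuous⟩ x _ (h2.trans hx.symm)

/-- The action of `π₁(M, p)` on the universal covering `X` by path lifting: `deckAction h hx γ` is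
the deck transformation sending the base point `x` to the endpoint of the lift of `γ` at `x`. -/
def deckAction {n : ℕ} [ChartedSpace (EuclideanSpace ℝ (Fin n)) X]
    [Bundle.RiemannianBundle (fun x : X => TangentSpace (𝓡 n) x)]
    [ChartedSpace (EuclideanSpace ℝ (Fin n)) M]
    [Bundle.RiemannianBundle (fun x : M => TangentSpace (𝓡 n) x)]
    [SimplyConnectedSpace X] {pr : X → M} (h : IsRiemannianCovering n pr) {x : X} {p : M}
    (hx : pr x = p) (γ : FundamentalGroup M p) : X → X :=
  have : LocallyPathConnectedSpace X :=
    ChartedSpace.locallyPathConnectedSpace (EuclideanSpace ℝ (Fin n)) X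
  ((existsUnique_deck h.isCoveringMap hx γ).choose : C(X, X))

end Deck

/-! ### Pointed equivariant Gromov-Hausdorff convergence -/

/-- `(f, φ, ψ)` is a pointed equivariant `ε`-Gromov-Hausdorff approximation from
`(X, x₀, Γ)` to `(Y, y₀, Λ)`, where `dX`, `dY` are the distances and `Γ`, `Λ` act through `aX`,
`aY`. Only the values of `f` on the ball of radius `1/ε` around `x₀`, of `φ` on
`Γ(1/ε) = {γ | d(γ x₀, x₀) < 1/ε}` and of `ψ` on `Λ(1/ε)` matter. -/
structure IsEquivariantGHApprox {X Y Γ Λ : Type*}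
    (dX : X → X → ℝ) (x₀ : X) (aX : Γ → X → X)
    (dY : Y → Y → ℝ) (y₀ : Y) (aY : Λ → Y → Y)
    (ε : ℝ) (f : X → Y) (φ : Γ → Λ) (ψ : Λ → Γ) : Prop where
  map_base : f x₀ = y₀
  almost_onto : ∀ y, dY y y₀ < 1 / ε → ∃ x, dX x x₀ < 1 / ε ∧ dY y (f x) < ε
  almost_isometric : ∀ x x', dX x x₀ < 1 / ε → dX x' x₀ < 1 / ε →
    |dY (f x) (f x') - dX x x'| < ε
  mapsTo_left : ∀ γ, dX (aX γ x₀) x₀ < 1 / ε → dY (aY (φ γ) y₀) y₀ < 1 / ε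
  mapsTo_right : ∀ μ, dY (aY μ y₀) y₀ < 1 / ε → dX (aX (ψ μ) x₀) x₀ < 1 / ε
  almost_equivariant_left : ∀ γ x, dX (aX γ x₀) x₀ < 1 / ε → dX x x₀ < 1 / ε →
    dX (aX γ x) x₀ < 1 / ε → dY (f (aX γ x)) (aY (φ γ) (f x)) < ε
  almost_equivariant_right : ∀ μ x, dY (aY μ y₀) y₀ < 1 / ε → dX x x₀ < 1 / ε →
    dX (aX (ψ μ) x) x₀ < 1 / ε → dY (f (aX (ψ μ) x)) (aY μ (f x)) < ε

/-- A group of isometries of `Y` that is closed in the full isometry group for the compact-open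
topology (uniform convergence on compact sets). -/
def IsClosedIsometryGroup {Y : Type*} [MetricSpace Y] (G : Subgroup (Y ≃ᵢ Y)) : Prop :=
  ∀ g : Y ≃ᵢ Y,
    (∀ K : Set Y, IsCompact K → ∀ ε > 0, ∃ h ∈ G, ∀ y ∈ K, dist (h y) (g y) < ε) → g ∈ G

/-- Pointed equivariant Gromov-Hausdorff convergence `(s_i⁻¹ X, x₀, Γ) → (Y, y₀, G)`, where
`s_i⁻¹ X` is `X` with its distance divided by `s_i`, `Γ` acts on `X` through `act`, and the limit
consists of a proper metric space `Y` and a closed group `G` of isometries of `Y`. -/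
def RescalingsConvergeEquivariantly {X Γ Y : Type*} [MetricSpace X] [MetricSpace Y]
    (s : ℕ → ℝ) (x₀ : X) (act : Γ → X → X) (y₀ : Y) (G : Subgroup (Y ≃ᵢ Y)) : Prop :=
  ProperSpace Y ∧ IsClosedIsometryGroup G ∧
  ∃ ε : ℕ → ℝ, (∀ i, 0 < ε i) ∧ Tendsto ε atTop (𝓝 0) ∧
    ∀ i, ∃ (f : X → Y) (φ : Γ → G) (ψ : G → Γ),
      IsEquivariantGHApprox (fun x x' => (s i)⁻¹ * dist x x') x₀ act
        dist y₀ (fun (g : G) y => (g : Y ≃ᵢ Y) y) (ε i) f φ ψ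

end

/-!
The orbit of the base point in the limit cannot be discrete because discreteness would produce a
finite nontrivial subgroup of the fundamental group `Γ`, generated by elements of small rescaled
displacement.

Write `|γ|` for the displacement `d(γ p', p')`. If the orbit `G o` is discrete, some ball of radius
`r` around `o` meets it only in `o`. For large `i` the equivariant approximation then opens a gap in
the rescaled displacements: `|γ| / s_i < r / 2` forces `|γ| / s_i < 2 ε_i`
(`IsEquivariantGHApprox.displacement_lt`). As `s_i → ∞`, any fixed `γ ≠ 1` has rescaled displacement
below `r / 4` for large `i`, and by subadditivity of `|·|` (`dist_deckAction_mul_le`) the gap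
confines all powers of `γ` to displacement below `s_i r / 4`. A fiber of the covering has only
finitely many points in a ball, and `Γ` acts freely on the fiber, so two powers of `γ` agree and `γ`
has finite order (`isOfFinOrder_of_dist_deckAction_pow_le`), against the absence of torsion.

The finiteness rests on the properness of the universal covering
(`IsRiemannianCovering.finite_fiber_inter_closedBall`). Completeness passes from the base to a
Riemannian covering (`IsRiemannianCovering.completeSpace`), because short paths lift to paths of the
same length and the points of a fiber are uniformly separated; a complete, locally compact length
space is proper (`properSpace_of_exists_dist_lt`). Deck transformations do not increase distances
because they are `C¹` with isometric differentials (`dist_deckAction_le`).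
-/

/-! ### Properness of complete length spaces -/

open Metric in
/-- A metric form of the Hopf–Rinow theorem: a complete, locally compact length space is proper.
The hypothesis `hlen` is the length-space property: a distance can be split almost additively at an
intermediate point. -/
theorem properSpace_of_exists_dist_lt {X : Type*} [MetricSpace X] [CompleteSpace X]
    [LocallyCompactSpace X]
    (hlen : ∀ (x y : X) (a b : ℝ), 0 < a → 0 < b → dist x y < a + b →
      ∃ z, dist x z < a ∧ dist z y < b) : ProperSpace X := by
  refine ⟨fun x R => ?_⟩
  -- The set of radii with compact closed ball is shown to be open and closed in `ℝ`.
  set S : Set ℝ := {r | IsCompact (closedBall x r)} with hS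
  have hdown : ∀ r ∈ S, ∀ r' ≤ r, r' ∈ S := fun r hr r' h =>
    IsCompact.of_isClosed_subset hr isClosed_closedBall (closedBall_subset_closedBall h)
  have h0 : (0 : ℝ) ∈ S := by simp [hS]
  have hopen : IsOpen S := by
    rw [Metric.isOpen_iff]
    intro r hr
    rcases lt_or_ge r 0 with hneg | hnn
    · refine ⟨-r, by linarith, fun t ht => hdown 0 h0 t ?_⟩
      rw [mem_ball, Real.dist_eq, abs_lt] at ht
      linarith
    obtain ⟨δ, hδ, hK⟩ := IsCompact.exists_isCompact_cthickening (s := closedBall x r) hr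
    have hmem : r + δ / 3 ∈ S := by
      refine IsCompact.of_isClosed_subset hK isClosed_closedBall fun y hy => ?_
      rw [mem_closedBall, dist_comm] at hy
      rcases eq_or_lt_of_le hnn with h | hpos
      · subst h
        refine mem_cthickening_of_dist_le y x δ _ (by simp) ?_
        rw [dist_comm]; linarith
      · obtain ⟨z, hz, hzy⟩ := hlen x y r δ hpos hδ (by linarith)
        refine mem_cthickening_of_dist_le y z δ _ ?_ ?_
        · rw [mem_closedBall, dist_comm]; exact hz.le
        · rw [dist_comm]; exact hzy.le
    refine ⟨δ / 3, by positivity, fun t ht => hdown _ hmem t ?_⟩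
    rw [mem_ball, Real.dist_eq, abs_lt] at ht
    linarith
  have hclosed : IsClosed S := by
    refine isClosed_of_closure_subset fun r hr => ?_
    rw [Metric.mem_closure_iff] at hr
    rcases le_or_gt r 0 with hle | hpos
    · exact hdown 0 h0 r hle
    refine TotallyBounded.isCompact_of_isClosed ?_ isClosed_closedBall
    rw [Metric.totallyBounded_iff]
    intro ε hε
    obtain ⟨t, htS, ht⟩ := hr (min (ε / 3) (r / 2)) (by positivity)
    rw [Real.dist_eq, lt_min_iff, abs_lt, abs_lt] at ht
    obtain ⟨F, hF, hcov⟩ := Metric.totallyBounded_iff.1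
      (IsCompact.totallyBounded (s := closedBall x t) htS) (ε / 3) (by positivity)
    refine ⟨F, hF, fun y hy => ?_⟩
    rw [mem_closedBall, dist_comm] at hy
    obtain ⟨z, hxz, hzy⟩ := hlen x y t (ε / 3) (by linarith [ht.2.2]) (by positivity)
      (by linarith [ht.1.2])
    have hz : z ∈ closedBall x t := by rw [mem_closedBall, dist_comm]; exact hxz.le
    obtain ⟨c, hc, hzc⟩ := Set.mem_iUnion₂.1 (hcov hz)
    refine Set.mem_iUnion₂.2 ⟨c, hc, ?_⟩
    rw [mem_ball] at hzc ⊢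
    calc dist y c ≤ dist y z + dist z c := dist_triangle _ _ _
      _ < ε := by rw [dist_comm y z]; linarith
  have : S = Set.univ := IsClopen.eq_univ ⟨hclosed, hopen⟩ ⟨0, h0⟩
  show R ∈ S
  rw [this]
  trivial

/-! ### Lengths of paths in Riemannian manifolds -/

section Length

variable {n : ℕ} {X : Type*} [MetricSpace X] [ChartedSpace (EuclideanSpace ℝ (Fin n)) X]
  [Bundle.RiemannianBundle (fun x : X => TangentSpace (𝓡 n) x)]
  [IsRiemannianManifold (𝓡 n) X]

/-- Points of a Riemannian manifold at distance less than `r` are joined by a globally defined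
`C¹` path of length less than `r`. -/
theorem exists_contMDiff_pathELength_lt {x y : X} {r : ℝ} (h : dist x y < r) :
    ∃ γ : ℝ → X, γ 0 = x ∧ γ 1 = y ∧ ContMDiff 𝓘(ℝ) (𝓡 n) 1 γ ∧
      Manifold.pathELength (𝓡 n) γ 0 1 < ENNReal.ofReal r := by
  have hr : Manifold.riemannianEDist (𝓡 n) x y < ENNReal.ofReal r := by
    rw [← IsRiemannianManifold.out, edist_dist]
    exact (ENNReal.ofReal_lt_ofReal_iff (dist_nonneg.trans_lt h)).2 h
  obtain ⟨γ, h0, h1, hγ, hlt, -⟩ :=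
    Manifold.exists_lt_locally_constant_of_riemannianEDist_lt hr zero_lt_one
  exact ⟨γ, h0, h1, hγ, hlt⟩

theorem edist_le_pathELength {γ : ℝ → X} (hγ : ContMDiff 𝓘(ℝ) (𝓡 n) 1 γ) {a b : ℝ}
    (hab : a ≤ b) : edist (γ a) (γ b) ≤ Manifold.pathELength (𝓡 n) γ a b := by
  rw [IsRiemannianManifold.out (I := 𝓡 n)]
  exact Manifold.riemannianEDist_le_pathELength hγ.contMDiffOn rfl rfl hab

/-- Riemannian manifolds are length spaces: cut a nearly shortest path where its distance
from `x` is slightly less than `a`. -/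
theorem exists_dist_lt_dist_lt (n : ℕ) {X : Type*} [MetricSpace X]
    [ChartedSpace (EuclideanSpace ℝ (Fin n)) X]
    [Bundle.RiemannianBundle (fun x : X => TangentSpace (𝓡 n) x)]
    [IsRiemannianManifold (𝓡 n) X] (x y : X) (a b : ℝ) (ha : 0 < a) (hb : 0 < b)
    (h : dist x y < a + b) : ∃ z, dist x z < a ∧ dist z y < b := by
  obtain ⟨c, hc, hca⟩ : ∃ c, max 0 (dist x y - b) < c ∧ c < a :=
    exists_between (max_lt ha (by linarith))
  rw [max_lt_iff] at hc
  obtain ⟨γ, h0, h1, hγ, hlt⟩ := exists_contMDiff_pathELength_lt (n := n)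
    (show dist x y < c + b by linarith)
  rcases lt_or_ge (dist x y) c with hxc | hxc
  · exact ⟨y, hxc.trans hca, by simpa using hb⟩
  obtain ⟨t, ht, hct⟩ : ∃ t ∈ Set.Icc (0 : ℝ) 1, dist x (γ t) = c := by
    have hcont : ContinuousOn (fun t => dist x (γ t)) (Set.Icc 0 1) :=
      (continuous_const.dist hγ.continuous).continuousOn
    exact intermediate_value_Icc zero_le_one hcont ⟨by simp [h0, hc.1.le], by simpa [h1] using hxc⟩
  refine ⟨γ t, hct ▸ hca, ?_⟩
  have e1 := edist_le_pathELength hγ ht.1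
  have e2 := edist_le_pathELength hγ ht.2
  rw [h0, edist_dist, hct] at e1
  rw [h1, edist_dist] at e2
  have hsum := (add_le_add e1 e2).trans_lt
    ((Manifold.pathELength_add (I := 𝓡 n) (γ := γ) ht.1 ht.2).trans_lt hlt)
  rw [← ENNReal.ofReal_add hc.1.le dist_nonneg,
    ENNReal.ofReal_lt_ofReal_iff (by linarith)] at hsum
  linarith

end Length

section Isometric

variable {n : ℕ} {X M : Type*} [MetricSpace X] [ChartedSpace (EuclideanSpace ℝ (Fin n)) X]
  [Bundle.RiemannianBundle (fun x : X => TangentSpace (𝓡 n) x)]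
  [MetricSpace M] [ChartedSpace (EuclideanSpace ℝ (Fin n)) M]
  [Bundle.RiemannianBundle (fun x : M => TangentSpace (𝓡 n) x)]

/-- A `C¹` map with isometric differentials preserves the length of `C¹` paths. -/
theorem pathELength_comp_of_norm_mfderiv {f : X → M} (hf : ContMDiff (𝓡 n) (𝓡 n) 1 f)
    (hn : ∀ (x : X) (v : TangentSpace (𝓡 n) x), ‖mfderiv (𝓡 n) (𝓡 n) f x v‖ = ‖v‖)
    {γ : ℝ → X} (hγ : ContMDiff 𝓘(ℝ) (𝓡 n) 1 γ) (a b : ℝ) :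
    Manifold.pathELength (𝓡 n) (f ∘ γ) a b = Manifold.pathELength (𝓡 n) γ a b := by
  simp only [Manifold.pathELength_eq_lintegral_mfderiv_Icc]
  congr 1
  ext t
  rw [mfderiv_comp t (hf.mdifferentiable one_ne_zero _) (hγ.mdifferentiable one_ne_zero _)]
  exact enorm_eq_iff_norm_eq.2 (hn (γ t) _)

theorem dist_map_le_of_norm_mfderiv [IsRiemannianManifold (𝓡 n) X] [IsRiemannianManifold (𝓡 n) M]
    {f : X → M} (hf : ContMDiff (𝓡 n) (𝓡 n) 1 f)
    (hn : ∀ (x : X) (v : TangentSpace (𝓡 n) x), ‖mfderiv (𝓡 n) (𝓡 n) f x v‖ = ‖v‖)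
    (x y : X) : dist (f x) (f y) ≤ dist x y := by
  refine le_of_forall_gt fun r hr => ?_
  obtain ⟨γ, h0, h1, hγ, hlt⟩ := exists_contMDiff_pathELength_lt (n := n) hr
  have := edist_le_pathELength (hf.comp hγ) zero_le_one
  rw [pathELength_comp_of_norm_mfderiv hf hn hγ] at this
  have := this.trans_lt hlt
  simp only [Function.comp, h0, h1, edist_dist] at this
  exact (ENNReal.ofReal_lt_ofReal_iff (dist_nonneg.trans_lt hr)).1 this

end Isometric

/-- A continuous lift of a `C^k` map through a local diffeomorphism is `C^k`. -/
theorem IsLocalDiffeomorph.contMDiff_of_comp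
    {E H E' H' E'' H'' A X M : Type*} [NormedAddCommGroup E] [NormedSpace ℝ E] [TopologicalSpace H]
    {I : ModelWithCorners ℝ E H} [NormedAddCommGroup E'] [NormedSpace ℝ E'] [TopologicalSpace H']
    {J : ModelWithCorners ℝ E' H'} [NormedAddCommGroup E''] [NormedSpace ℝ E'']
    [TopologicalSpace H''] {K : ModelWithCorners ℝ E'' H''}
    [TopologicalSpace A] [ChartedSpace H A] [TopologicalSpace X] [ChartedSpace H' X]
    [TopologicalSpace M] [ChartedSpace H'' M] {k m : ℕ∞ω} (hkm : k ≤ m)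
    {f : X → M} (hf : IsLocalDiffeomorph J K m f) {g : A → X} (hg : Continuous g)
    (hfg : ContMDiff I K k (f ∘ g)) : ContMDiff I J k g := by
  intro a
  have h := hf (g a)
  have hc := (h.localInverse_contMDiffAt.of_le hkm).comp (x := a) (g := h.localInverse)
    (f := f ∘ g) (hfg a)
  refine hc.congr_of_eventuallyEq ?_
  exact (hg.continuousAt.eventually h.localInverse_eventuallyEq_left).mono fun _ h => h.symm

/-! ### Riemannian coverings -/

namespace IsRiemannianCovering

variable {n : ℕ} {X M : Type*} [MetricSpace X] [ChartedSpace (EuclideanSpace ℝ (Fin n)) X]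
  [Bundle.RiemannianBundle (fun x : X => TangentSpace (𝓡 n) x)]
  [IsRiemannianManifold (𝓡 n) X]
  [MetricSpace M] [ChartedSpace (EuclideanSpace ℝ (Fin n)) M]
  [Bundle.RiemannianBundle (fun x : M => TangentSpace (𝓡 n) x)]
  [IsRiemannianManifold (𝓡 n) M]
  {pr : X → M}

omit [IsRiemannianManifold (𝓡 n) X] [IsRiemannianManifold (𝓡 n) M] in
theorem contMDiff_one (h : IsRiemannianCovering n pr) : ContMDiff (𝓡 n) (𝓡 n) 1 pr :=
  h.isLocalDiffeomorph.contMDiff.of_le (by simp)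

omit [IsRiemannianManifold (𝓡 n) X] [IsRiemannianManifold (𝓡 n) M] in
theorem contMDiff_one_of_comp {E H A : Type*} [NormedAddCommGroup E] [NormedSpace ℝ E]
    [TopologicalSpace H] {I : ModelWithCorners ℝ E H} [TopologicalSpace A] [ChartedSpace H A]
    (h : IsRiemannianCovering n pr) {g : A → X} (hg : Continuous g)
    (hfg : ContMDiff I (𝓡 n) 1 (pr ∘ g)) : ContMDiff I (𝓡 n) 1 g :=
  IsLocalDiffeomorph.contMDiff_of_comp (by simp) h.isLocalDiffeomorph hg hfg

theorem dist_map_le (h : IsRiemannianCovering n pr) (x y : X) : dist (pr x) (pr y) ≤ dist x y :=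
  dist_map_le_of_norm_mfderiv h.contMDiff_one h.norm_mfderiv x y

/-- Lifting a short path of `M` shows that a point near `pr x` is the image of a point equally near
to `x`. -/
theorem exists_dist_lt_of_dist_map_lt (h : IsRiemannianCovering n pr) {x : X} {q : M} {r : ℝ}
    (hr : dist (pr x) q < r) : ∃ y, pr y = q ∧ dist x y < r := by
  obtain ⟨γ, h0, h1, hγ, hlt⟩ := exists_contMDiff_pathELength_lt (n := n) hr
  obtain ⟨Γ, ⟨hΓ0, hΓ⟩, -⟩ := h.isCoveringMap.existsUnique_continuousMap_lifts
    (⟨γ, hγ.continuous⟩ : C(ℝ, M)) 0 x h0.symm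
  have hcomp : pr ∘ Γ = γ := hΓ
  have hsm : ContMDiff 𝓘(ℝ) (𝓡 n) 1 Γ :=
    h.contMDiff_one_of_comp Γ.continuous (hcomp ▸ hγ)
  refine ⟨Γ 1, (congrFun hcomp 1).trans h1, ?_⟩
  have hle := edist_le_pathELength hsm zero_le_one
  rw [← pathELength_comp_of_norm_mfderiv h.contMDiff_one h.norm_mfderiv hsm, hcomp] at hle
  have := hle.trans_lt hlt
  rw [hΓ0, edist_dist] at this
  exact (ENNReal.ofReal_lt_ofReal_iff (dist_nonneg.trans_lt hr)).1 this

/-- Distinct points of a fiber are uniformly far apart: a short path between two of them stays over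
an evenly covered ball, hence in one sheet. -/
theorem exists_pos_forall_eq_of_dist_lt (h : IsRiemannianCovering n pr) (q : M) :
    ∃ r > 0, ∀ y y' : X, pr y = q → pr y' = q → dist y y' < r → y = y' := by
  rcases isEmpty_or_nonempty (pr ⁻¹' {q}) with hE | hE
  · exact ⟨1, one_pos, fun y _ hy => (hE.false ⟨y, hy⟩).elim⟩
  have hcov := h.isCoveringMap q
  have := hcov.discreteTopology_fiber
  set t := hcov.toTrivialization
  have hq : q ∈ t.baseSet := hcov.mem_toTrivialization_baseSet
  obtain ⟨r, hr, hball⟩ := Metric.isOpen_iff.1 t.open_baseSet q hq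
  refine ⟨r, hr, fun y y' hy hy' hlt => ?_⟩
  obtain ⟨γ, h0, h1, hγ, hl⟩ := exists_contMDiff_pathELength_lt (n := n) hlt
  have hmem : ∀ s ∈ Set.Icc (0 : ℝ) 1, γ s ∈ t.source := fun s hs => by
    rw [t.mem_source]
    refine hball ?_
    have hle := (edist_le_pathELength hγ hs.1).trans_lt
      ((Manifold.pathELength_mono le_rfl hs.2).trans_lt hl)
    rw [h0, edist_dist] at hle
    rw [Metric.mem_ball, dist_comm, ← hy]
    exact (h.dist_map_le _ _).trans_lt ((ENNReal.ofReal_lt_ofReal_iff hr).1 hle)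
  have hcont : ContinuousOn (fun s => (t (γ s)).2) (Set.Icc (0 : ℝ) 1) :=
    (t.continuousOn_toFun.comp hγ.continuous.continuousOn hmem).snd
  have hconst := isPreconnected_Icc.constant hcont
    (Set.left_mem_Icc.2 zero_le_one) (Set.right_mem_Icc.2 zero_le_one)
  have hs0 := hmem 0 (Set.left_mem_Icc.2 zero_le_one)
  have hs1 := hmem 1 (Set.right_mem_Icc.2 zero_le_one)
  rw [h0] at hs0
  rw [h1] at hs1
  simp only [h0, h1] at hconst
  refine t.injOn hs0 hs1 (Prod.ext ?_ hconst)
  exact (t.coe_fst hs0).trans ((hy.trans hy'.symm).trans (t.coe_fst hs1).symm)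

/-- A Riemannian covering of a complete manifold is complete. -/
theorem completeSpace [CompleteSpace M] (h : IsRiemannianCovering n pr) : CompleteSpace X := by
  refine Metric.complete_of_cauchySeq_tendsto fun u hu => ?_
  have hlip : LipschitzWith 1 pr := LipschitzWith.of_dist_le_mul (by simpa using h.dist_map_le)
  obtain ⟨q, hq⟩ := cauchySeq_tendsto_of_complete (hlip.uniformContinuous.comp_cauchySeq hu)
  obtain ⟨r, hr, hsep⟩ := h.exists_pos_forall_eq_of_dist_lt q
  -- Every late term lies near a point of the fiber over `q`; by uniform separation this point does
  -- not depend on the term, and it is the limit.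
  have key : ∀ ε > 0, ∃ N, ∀ k ≥ N, ∃ y, pr y = q ∧ dist (u k) y < ε := fun ε hε => by
    obtain ⟨N, hN⟩ := Metric.tendsto_atTop.1 hq ε hε
    exact ⟨N, fun k hk => h.exists_dist_lt_of_dist_map_lt (hN k hk)⟩
  obtain ⟨N₁, hN₁⟩ := key (r / 3) (by positivity)
  obtain ⟨N₂, hN₂⟩ := Metric.cauchySeq_iff.1 hu (r / 3) (by positivity)
  obtain ⟨y, hy, huy⟩ := hN₁ (max N₁ N₂) (le_max_left _ _)
  refine ⟨y, Metric.tendsto_atTop.2 fun ε hε => ?_⟩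
  obtain ⟨N₃, hN₃⟩ := key (min ε (r / 3)) (by positivity)
  refine ⟨max N₃ N₂, fun k hk => ?_⟩
  obtain ⟨z, hz, huz⟩ := hN₃ k (le_of_max_le_left hk)
  have hd := hN₂ k (le_of_max_le_right hk) (max N₁ N₂) (le_max_right _ _)
  have hzy : z = y := by
    refine hsep z y hz hy ?_
    calc dist z y ≤ dist z (u k) + dist (u k) (u (max N₁ N₂)) + dist (u (max N₁ N₂)) y :=
          dist_triangle4 _ _ _ _
      _ < r := by rw [dist_comm z]; linarith [huz.trans_le (min_le_right _ _)]
  exact hzy ▸ huz.trans_le (min_le_left _ _)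

theorem finite_fiber_inter_closedBall [CompleteSpace M] (h : IsRiemannianCovering n pr) (q : M)
    (x : X) (R : ℝ) : (pr ⁻¹' {q} ∩ Metric.closedBall x R).Finite := by
  have := h.completeSpace
  have : LocallyCompactSpace X := Manifold.locallyCompact_of_finiteDimensional (𝓡 n)
  have : ProperSpace X := properSpace_of_exists_dist_lt (exists_dist_lt_dist_lt n)
  have hdisc : IsDiscrete (pr ⁻¹' {q}) := ⟨(h.isCoveringMap q).discreteTopology_fiber⟩
  exact ((isCompact_closedBall x R).inter_left
    (isClosed_singleton.preimage h.isCoveringMap.continuous)).finite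
      (hdisc.mono Set.inter_subset_left)

end IsRiemannianCovering

/-! ### The deck action -/

/-- For a simply connected covering, the action of the fundamental group on a fiber is free. -/
theorem IsCoveringMap.eq_one_of_monodromy_eq {X M : Type*} [TopologicalSpace X]
    [TopologicalSpace M] [SimplyConnectedSpace X] {pr : X → M} (cov : IsCoveringMap pr) {p : M}
    {e : pr ⁻¹' {p}} {γ : FundamentalGroup M p} (hγ : cov.monodromy γ e = e) : γ = 1 := by
  obtain ⟨x, rfl⟩ := e
  have h1 := cov.map_liftPathQuotient γ ⟨x, rfl⟩
  have h2 : (cov.liftPathQuotient γ ⟨x, rfl⟩).cast rfl (congrArg Subtype.val hγ).symm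
      = Path.Homotopic.Quotient.refl x := Subsingleton.elim _ _
  have h3 := congrArg (fun c => Path.Homotopic.Quotient.map c ⟨pr, cov.continuous⟩) h2
  simp only [Path.Homotopic.Quotient.map_cast, h1] at h3
  have h4 : (Path.Homotopic.Quotient.refl x).map ⟨pr, cov.continuous⟩ =
      Path.Homotopic.Quotient.refl (pr x) :=
    congrArg Path.Homotopic.Quotient.mk
      (Path.ext rfl : (Path.refl x).map cov.continuous = Path.refl (pr x))
  rw [h4] at h3
  change (γ : Path.Homotopic.Quotient (pr x) (pr x)) = .refl (pr x)
  exact (Path.Homotopic.Quotient.cast_rfl_rfl γ).symm.trans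
    ((Path.Homotopic.Quotient.cast_cast γ _ _ _ _).symm.trans h3)

section Deck

variable {n : ℕ} {X M : Type*} [MetricSpace X] [ChartedSpace (EuclideanSpace ℝ (Fin n)) X]
  [Bundle.RiemannianBundle (fun x : X => TangentSpace (𝓡 n) x)]
  [MetricSpace M] [ChartedSpace (EuclideanSpace ℝ (Fin n)) M]
  [Bundle.RiemannianBundle (fun x : M => TangentSpace (𝓡 n) x)]
  [SimplyConnectedSpace X] {pr : X → M} (h : IsRiemannianCovering n pr) {x : X} {p : M}
  (hx : pr x = p)

theorem continuous_deckAction (γ : FundamentalGroup M p) : Continuous (deckAction h hx γ) := by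
  have : LocallyPathConnectedSpace X :=
    ChartedSpace.locallyPathConnectedSpace (EuclideanSpace ℝ (Fin n)) X
  exact (existsUnique_deck h.isCoveringMap hx γ).choose.continuous

theorem deckAction_basepoint (γ : FundamentalGroup M p) :
    deckAction h hx γ x = (h.isCoveringMap.monodromy γ ⟨x, hx⟩ : pr ⁻¹' {p}).1 := by
  have : LocallyPathConnectedSpace X :=
    ChartedSpace.locallyPathConnectedSpace (EuclideanSpace ℝ (Fin n)) X
  exact (existsUnique_deck h.isCoveringMap hx γ).choose_spec.1.1

theorem deckAction_one_basepoint : deckAction h hx 1 x = x := by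
  rw [deckAction_basepoint, FundamentalGroup.one_def, IsCoveringMap.monodromy_refl]
  rfl

theorem comp_deckAction (γ : FundamentalGroup M p) : pr ∘ deckAction h hx γ = pr := by
  have : LocallyPathConnectedSpace X :=
    ChartedSpace.locallyPathConnectedSpace (EuclideanSpace ℝ (Fin n)) X
  exact (existsUnique_deck h.isCoveringMap hx γ).choose_spec.1.2

/-- Deck transformations carry lifts of a loop to lifts of the same loop. The factors come in
reversed order because the product `η * γ` in `FundamentalGroup` traverses `γ` first. -/
theorem deckAction_mul_basepoint (γ η : FundamentalGroup M p) :
    deckAction h hx (η * γ) x = deckAction h hx γ (deckAction h hx η x) := by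
  set F : C(X, X) := ⟨deckAction h hx γ, continuous_deckAction h hx γ⟩
  have hcomp : (⟨pr, h.isCoveringMap.continuous⟩ : C(X, M)).comp F =
      ⟨pr, h.isCoveringMap.continuous⟩ := ContinuousMap.ext (congrFun (comp_deckAction h hx γ))
  have hprF : ∀ y, pr (F y) = pr y := congrFun (comp_deckAction h hx γ)
  set e : pr ⁻¹' {p} := ⟨x, hx⟩
  have key : h.isCoveringMap.monodromy η ⟨F x, (hprF x).trans hx⟩ =
      ⟨F (h.isCoveringMap.monodromy η e).1,
        (hprF _).trans (h.isCoveringMap.monodromy η e).2⟩ := by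
    refine h.isCoveringMap.monodromy_eq_of_map_eq
      ((h.isCoveringMap.liftPathQuotient η e).map F) ?_
    rw [← Path.Homotopic.Quotient.map_comp]
    convert h.isCoveringMap.map_liftPathQuotient η e using 2
    · exact hprF _
    · exact hprF _
    · grind
  rw [deckAction_basepoint, deckAction_basepoint h hx η, FundamentalGroup.mul_def,
    IsCoveringMap.monodromy_trans_apply]
  have hFx : h.isCoveringMap.monodromy γ e = ⟨F x, (hprF x).trans hx⟩ :=
    Subtype.ext (deckAction_basepoint h hx γ).symm
  rw [hFx, key]
  rfl

theorem dist_deckAction_le [IsRiemannianManifold (𝓡 n) X] (γ : FundamentalGroup M p) (y z : X) :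
    dist (deckAction h hx γ y) (deckAction h hx γ z) ≤ dist y z := by
  have hsm : ContMDiff (𝓡 n) (𝓡 n) 1 (deckAction h hx γ) :=
    h.contMDiff_one_of_comp (continuous_deckAction h hx γ)
      ((comp_deckAction h hx γ).symm ▸ h.contMDiff_one)
  refine dist_map_le_of_norm_mfderiv hsm (fun y v => ?_) y z
  have hd := mfderiv_comp y (h.contMDiff_one.mdifferentiable one_ne_zero (deckAction h hx γ y))
    (hsm.mdifferentiable one_ne_zero y)
  have hcongr : ∀ f g : X → M, f = g →
      ‖mfderiv (𝓡 n) (𝓡 n) f y v‖ = ‖mfderiv (𝓡 n) (𝓡 n) g y v‖ := by rintro f _ rfl; rfl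
  have h2 := hcongr _ _ (comp_deckAction h hx γ)
  rw [hd, h.norm_mfderiv] at h2
  exact (h.norm_mfderiv _ _).symm.trans h2

theorem dist_deckAction_mul_le [IsRiemannianManifold (𝓡 n) X] (γ η : FundamentalGroup M p) :
    dist (deckAction h hx (η * γ) x) x ≤
      dist (deckAction h hx η x) x + dist (deckAction h hx γ x) x := by
  rw [deckAction_mul_basepoint]
  exact (dist_triangle _ (deckAction h hx γ x) _).trans
    (add_le_add_left (dist_deckAction_le h hx γ _ _) _)

/-- Since a bounded part of a fiber is finite and the action is free, an element whose powers move
the base point by a bounded amount has finite order. -/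
theorem isOfFinOrder_of_dist_deckAction_pow_le [IsRiemannianManifold (𝓡 n) X]
    [IsRiemannianManifold (𝓡 n) M] [CompleteSpace M] {γ : FundamentalGroup M p} {R : ℝ}
    (hR : ∀ k : ℕ, dist (deckAction h hx (γ ^ k) x) x ≤ R) : IsOfFinOrder γ := by
  have hmaps : Set.MapsTo (fun k : ℕ => deckAction h hx (γ ^ k) x) Set.univ
      (pr ⁻¹' {p} ∩ Metric.closedBall x R) := fun k _ =>
    ⟨(congrFun (comp_deckAction h hx (γ ^ k)) x).trans hx, hR k⟩
  obtain ⟨k, -, l, -, hkl, heq⟩ := Set.infinite_univ.exists_ne_map_eq_of_mapsTo hmaps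
    (h.finite_fiber_inter_closedBall p x R)
  wlog hlt : k < l generalizing k l
  · exact this l k hkl.symm heq.symm (hkl.lt_or_gt.resolve_left hlt)
  refine isOfFinOrder_iff_pow_eq_one.2 ⟨l - k, Nat.sub_pos_of_lt hlt, ?_⟩
  refine h.isCoveringMap.eq_one_of_monodromy_eq (e := ⟨x, hx⟩) ?_
  refine (h.isCoveringMap.monodromyPerm p (γ ^ k)).injective ?_
  rw [← IsCoveringMap.coe_monodromyPerm, ← Equiv.Perm.mul_apply, ← map_mul, ← pow_add,
    Nat.add_sub_cancel' hlt.le]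
  simp only [deckAction_basepoint] at heq
  exact (Subtype.ext heq).symm

end Deck

/-! ### Discrete orbits of the limit group -/

/-- If the orbit of `y₀` avoids the punctured ball of radius `r`, then the displacements of the base
point `x₀` have a gap: below a threshold close to `r` they are all smaller than `2 * ε`. -/
theorem IsEquivariantGHApprox.displacement_lt {X Y Γ Λ : Type*} [MetricSpace Y]
    {dX : X → X → ℝ} {x₀ : X} {aX : Γ → X → X} {y₀ : Y} {aY : Λ → Y → Y} {ε r : ℝ}
    {f : X → Y} {φ : Γ → Λ} {ψ : Λ → Γ}
    (h : IsEquivariantGHApprox dX x₀ aX dist y₀ aY ε f φ ψ) (hε : 0 < ε) (hX : dX x₀ x₀ = 0)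
    (hr : ∀ μ, dist (aY μ y₀) y₀ < r → aY μ y₀ = y₀) {γ : Γ}
    (hγε : dX (aX γ x₀) x₀ < 1 / ε) (hγr : dX (aX γ x₀) x₀ < r - 2 * ε) :
    dX (aX γ x₀) x₀ < 2 * ε := by
  have h0 : dX x₀ x₀ < 1 / ε := by rw [hX]; positivity
  have h1 := abs_lt.1 (h.almost_isometric _ _ hγε h0)
  have h2 := h.almost_equivariant_left γ x₀ hγε h0 hγε
  rw [h.map_base] at h1 h2
  have h3 := hr (φ γ) (by
    have := dist_triangle_left (aY (φ γ) y₀) y₀ (f (aX γ x₀))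
    linarith [h1.2])
  rw [h3] at h2
  linarith [h1.1]

theorem mainTheorem3 {n : ℕ}
    -- `M` is an open (complete, non-compact, connected) Riemannian `n`-manifold with `Ric ≥ 0`
    {M : Type*} [MetricSpace M] [ChartedSpace (EuclideanSpace ℝ (Fin n)) M]
    [IsManifold (𝓡 n) ∞ M]
    [Bundle.RiemannianBundle (fun x : M => TangentSpace (𝓡 n) x)]
    [IsContMDiffRiemannianBundle (𝓡 n) ∞ (EuclideanSpace ℝ (Fin n))
      (fun x : M => TangentSpace (𝓡 n) x)]
    [IsRiemannianManifold (𝓡 n) M]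
    [ConnectedSpace M] [CompleteSpace M] [NoncompactSpace M]
    (hRic : RicciNonneg n M)
    -- `pr : M' → M` is its Riemannian universal covering
    {M' : Type*} [MetricSpace M'] [ChartedSpace (EuclideanSpace ℝ (Fin n)) M']
    [IsManifold (𝓡 n) ∞ M']
    [Bundle.RiemannianBundle (fun x : M' => TangentSpace (𝓡 n) x)]
    [IsContMDiffRiemannianBundle (𝓡 n) ∞ (EuclideanSpace ℝ (Fin n))
      (fun x : M' => TangentSpace (𝓡 n) x)]
    [IsRiemannianManifold (𝓡 n) M']
    [SimplyConnectedSpace M']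
    (pr : M' → M) (hpr : IsRiemannianCovering n pr)
    (p : M) (p' : M') (hp : pr p' = p)
    -- the fundamental group is nontrivial and torsion free
    [Nontrivial (FundamentalGroup M p)]
    (hΓ : ∀ γ : FundamentalGroup M p, IsOfFinOrder γ → γ = 1)
    -- an equivariant tangent cone at infinity
    (s : ℕ → ℝ) (hs_pos : ∀ i, 0 < s i) (hs : Tendsto s atTop atTop)
    {Y : Type*} [MetricSpace Y] (o : Y) (G : Subgroup (Y ≃ᵢ Y))
    (hconv : RescalingsConvergeEquivariantly s p' (deckAction hpr hp) o G) :
    ¬ IsDiscrete {y : Y | ∃ g ∈ G, g o = y} := by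
  intro hdisc
  obtain ⟨-, -, ε, hε_pos, hε, happ⟩ := hconv
  -- Discreteness of the orbit at `o`.
  obtain ⟨r, hr, hball⟩ : ∃ r > 0, ∀ g : G, dist ((g : Y ≃ᵢ Y) o) o < r → (g : Y ≃ᵢ Y) o = o := by
    obtain ⟨r, hr, hsub⟩ := Metric.exists_ball_inter_eq_singleton_of_mem_discrete hdisc
      (show o ∈ {y : Y | ∃ g ∈ G, g o = y} from ⟨1, G.one_mem, rfl⟩)
    refine ⟨r, hr, fun g hg => ?_⟩
    exact hsub.subset ⟨hg, g.1, g.2, rfl⟩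
  obtain ⟨γ, hγ⟩ := exists_ne (1 : FundamentalGroup M p)
  set D : FundamentalGroup M p → ℝ := fun η => dist (deckAction hpr hp η p') p' with hD
  -- A scale at which the approximation is fine and `γ` has small rescaled displacement.
  obtain ⟨i, hi₁, hi₂, hi₃⟩ : ∃ i, ε i < r / 8 ∧ ε i < 1 / r ∧ D γ * 4 / r < s i :=
    ((hε.eventually_lt_const (by positivity)).and ((hε.eventually_lt_const (by positivity)).and
      (hs.eventually_gt_atTop _))).exists
  obtain ⟨f, φ, ψ, h⟩ := happ i
  have hs_inv := inv_pos.2 (hs_pos i)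
  have hεr : r < 1 / ε i := by rwa [lt_one_div hr (hε_pos i)]
  have hγs : (s i)⁻¹ * D γ < r / 4 := by
    rw [inv_mul_lt_iff₀ (hs_pos i)]
    rw [div_lt_iff₀ hr] at hi₃
    linarith
  -- The gap keeps all powers of `γ` in the ball of rescaled radius `r / 4`.
  have hpow : ∀ k : ℕ, (s i)⁻¹ * D (γ ^ k) < r / 4 := by
    intro k
    induction k with
    | zero =>
      have : D (γ ^ 0) = 0 := by simp only [hD, pow_zero, deckAction_one_basepoint, dist_self]
      rw [this, mul_zero]
      positivity
    | succ k ih =>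
      have hle : (s i)⁻¹ * D (γ ^ (k + 1)) ≤ (s i)⁻¹ * D (γ ^ k) + (s i)⁻¹ * D γ := by
        rw [← mul_add, pow_succ]
        exact mul_le_mul_of_nonneg_left (dist_deckAction_mul_le hpr hp γ (γ ^ k)) hs_inv.le
      have := h.displacement_lt (γ := γ ^ (k + 1)) (hε_pos i) (by simp) hball
        (by change (s i)⁻¹ * D (γ ^ (k + 1)) < _; linarith)
        (by change (s i)⁻¹ * D (γ ^ (k + 1)) < _; linarith)
      change (s i)⁻¹ * D (γ ^ (k + 1)) < _ at this
      linarith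
  refine hγ (hΓ γ (isOfFinOrder_of_dist_deckAction_pow_le hpr hp (R := s i * (r / 4)) fun k => ?_))
  exact ((inv_mul_lt_iff₀ (hs_pos i)).1 (hpow k)).le
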